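/- There are a deterministic algorithm and a polynomial $p$ such that, for all $n,k\ge 0$ and every family $\mathcal F$ of $2$-element subsets of an $n$-element set, the algorithm, given $n$, $k$ and $\mathcal F$, computes the number of $k$-packings in $\mathcal F$ (sets of $k$ mutually disjoint members of $\mathcal F$) in time at most $p(n,k)\cdot 3^{k}\max\{1,\binom{n}{k}\}$ and, in the same run, in space at most $p(n,k)$. In particular, for $k\le n$ the time is $O^{*}\big(3^{k}\binom{n}{k}\big)$, where $O^{*}$ suppresses a factor polynomial in $n$ and $k$. Here time and space are measured in bits: the algorithm is a fixed program for a random access machine on natural numbers, each step costs time according to the bit lengths of the numbers and addresses it handles, and space is the largest total number of bits of the addresses and contents of the nonzero cells (input included) at any moment; $\mathcal F$ is given as its symmetric $n\times n$ $0/1$ matrix. -/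

import Mathlib

/-! Counting packings, and a random access machine with logarithmic cost. -/

/-- The number of `k`-packings in `F`: sets of `k` mutually disjoint members of `F`. -/
def numPackings {n : ℕ} (F : Finset (Finset (Fin n))) (k : ℕ) : ℕ :=
  ((F.powersetCard k).filter
    (fun P => ∀ A ∈ P, ∀ B ∈ P, A ≠ B → Disjoint A B)).card

namespace RAM

/-- A machine state: registers, which a program can only name explicitly (so that each program
uses a fixed finite number of them), and a random access memory, which is only reached through
addresses held in registers. Both hold natural numbers of arbitrary size, and all but finitely
many cells are `0`. -/
structure State where
  reg : ℕ →₀ ℕ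
  mem : ℕ →₀ ℕ

/-- The bits needed to write down all nonzero cells: for each one its address and its contents. -/
def cellBits (f : ℕ →₀ ℕ) : ℕ := f.sum (fun a v => Nat.size a + Nat.size v)

/-- The space, in bits, occupied by a state. -/
def State.bits (s : State) : ℕ := cellBits s.reg + cellBits s.mem

/-- Arithmetic operations; `sub` is truncated and `div` rounds down (with value `0` if the
divisor is `0`). -/
inductive Op where
  | add
  | sub
  | mul
  | div

def Op.eval : Op → ℕ → ℕ → ℕ
  | .add, x, y => x + y
  | .sub, x, y => x - y
  | .mul, x, y => x * y
  | .div, x, y => x / y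

/-- The bit cost of the schoolbook methods. -/
def Op.cost : Op → ℕ → ℕ → ℕ
  | .add, x, y => 1 + Nat.size x + Nat.size y
  | .sub, x, y => 1 + Nat.size x + Nat.size y
  | .mul, x, y => (1 + Nat.size x) * (1 + Nat.size y)
  | .div, x, y => (1 + Nat.size x) * (1 + Nat.size y)

inductive Instr where
  /-- `reg d := c` -/
  | const (d c : ℕ)
  /-- `reg d := reg a o reg b` -/
  | arith (o : Op) (d a b : ℕ)
  /-- `reg d := mem (reg a)` -/
  | load (d a : ℕ)
  /-- `mem (reg a) := reg b` -/
  | store (a b : ℕ)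

/-- The state after an instruction. -/
noncomputable def Instr.exec : Instr → State → State
  | .const d c, s => { s with reg := s.reg.update d c }
  | .arith o d a b, s => { s with reg := s.reg.update d (o.eval (s.reg a) (s.reg b)) }
  | .load d a, s => { s with reg := s.reg.update d (s.mem (s.reg a)) }
  | .store a b, s => { s with mem := s.mem.update (s.reg a) (s.reg b) }

/-- The time an instruction takes: bit lengths of all numbers and addresses handled count. -/
def Instr.cost : Instr → State → ℕ
  | .const _ c, _ => 1 + Nat.size c
  | .arith o _ a b, s => o.cost (s.reg a) (s.reg b)
  | .load _ a, s => 1 + Nat.size (s.reg a) + Nat.size (s.mem (s.reg a))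
  | .store a b, s => 1 + Nat.size (s.reg a) + Nat.size (s.reg b)

/-- Programs. -/
inductive Prog where
  | skip
  | instr (i : Instr)
  | seq (p q : Prog)
  /-- if `reg r ≠ 0` then `p` else `q` -/
  | ite (r : ℕ) (p q : Prog)
  /-- while `reg r ≠ 0` do `p` -/
  | loop (r : ℕ) (p : Prog)

/-- `Run p s s' t b`: the program `p`, started in state `s`, halts in state `s'` after time `t`,
and `b` is the maximum of the space occupied by the states passed through
(including `s` and `s'`). -/
inductive Run : Prog → State → State → ℕ → ℕ → Prop where
  | skip (s : State) : Run .skip s s 1 s.bits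
  | instr (i : Instr) (s : State) :
      Run (.instr i) s (i.exec s) (i.cost s) (max s.bits (i.exec s).bits)
  | seq {p q : Prog} {s s₁ s₂ : State} {t₁ t₂ b₁ b₂ : ℕ} :
      Run p s s₁ t₁ b₁ → Run q s₁ s₂ t₂ b₂ →
      Run (.seq p q) s s₂ (t₁ + t₂) (max b₁ b₂)
  | ite_true {r : ℕ} {p q : Prog} {s s' : State} {t b : ℕ} :
      s.reg r ≠ 0 → Run p s s' t b →
      Run (.ite r p q) s s' (1 + Nat.size (s.reg r) + t) b
  | ite_false {r : ℕ} {p q : Prog} {s s' : State} {t b : ℕ} :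
      s.reg r = 0 → Run q s s' t b →
      Run (.ite r p q) s s' (1 + Nat.size (s.reg r) + t) b
  | loop_done {r : ℕ} {p : Prog} {s : State} :
      s.reg r = 0 → Run (.loop r p) s s (1 + Nat.size (s.reg r)) s.bits
  | loop_step {r : ℕ} {p : Prog} {s s₁ s₂ : State} {t₁ t₂ b₁ b₂ : ℕ} :
      s.reg r ≠ 0 → Run p s s₁ t₁ b₁ → Run (.loop r p) s₁ s₂ t₂ b₂ →
      Run (.loop r p) s s₂ (1 + Nat.size (s.reg r) + t₁ + t₂) (max b₁ b₂)

/-- The memory holding a family `F` of 2-element subsets of `{0, …, n - 1}` as an `n × n` matrix: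
cell `i * n + j` contains `1` if `{i, j}` is a member of `F`; all other cells contain `0`. -/
noncomputable def pairMatrix {n : ℕ} (F : Finset (Finset (Fin n))) : ℕ →₀ ℕ :=
  Finsupp.onFinset (Finset.range (n * n))
    (fun a => if ∃ i j : Fin n, a = (i : ℕ) * n + (j : ℕ) ∧ ({i, j} : Finset (Fin n)) ∈ F
      then 1 else 0)
    (by
      intro a ha
      have h : ∃ i j : Fin n, a = (i : ℕ) * n + (j : ℕ) ∧ ({i, j} : Finset (Fin n)) ∈ F := by
        by_contra hc
        exact ha (if_neg hc)
      obtain ⟨i, j, rfl, -⟩ := h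
      rw [Finset.mem_range]
      have h1 : ((i : ℕ) + 1) * n ≤ n * n := Nat.mul_le_mul_right n i.isLt
      have h2 := j.isLt
      rw [Nat.add_mul] at h1
      omega)

/-- The initial state on input `n`, `k`, `F`: register `0` holds `n`, register `1` holds `k`, the
memory holds `F`, and every other cell is `0`. -/
noncomputable def input (n k : ℕ) (F : Finset (Finset (Fin n))) : State where
  reg := Finsupp.single 0 n + Finsupp.single 1 k
  mem := pairMatrix F

end RAM

/-! Order the vertices and encode a packing by the map `f` that sends the lower end of each pair to
its upper end and fixes every other vertex. Let `A` be the set of upper ends, with `|A| = k`. For `T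
⊆ A`, the product over `j ∉ A` of `1 + z * #{i ∈ T | j < i, {j, i} ∈ F}` generates the upward maps
that fix `A` pointwise and send moved elements into `T`; `z` marks moved elements
(`prod_one_add_card_eq`). Inclusion-exclusion over `T` keeps the maps whose moved elements have
image exactly `A`. Such a map moves at least `k` elements, and it moves exactly `k` precisely when
it encodes a packing. So the signed sum over all pairs `(A, T)` is `z ^ k` times a polynomial with
nonnegative coefficients whose constant term is the number of packings
(`exists_sum_eq_card_matchingMaps`, `numPackings_eq_card_matchingMaps`). Evaluating at one integer
`Z` larger than that number, dividing by `Z ^ k` and reducing modulo `Z` gives the answer.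

There are only `2 ^ k * n.choose k` pairs `(A, T)`. They are numbered consecutively, and each number
is decoded from the top vertex downwards while its product is computed (`signedProd`, `ev_scan`).
Since the factor of `j` involves only elements above `j`, a single pass with a bit mask of the part
of `T` already decoded suffices, and nothing is stored besides finitely many numbers of polynomial
bit length. -/

namespace RAM

/-! ### Calculus for running programs with bounded registers. -/

/-- The value written by an instruction, for registers given as a list. -/
def Instr.val (M : ℕ →₀ ℕ) : Instr → List ℕ → ℕ
  | .const _ c, _ => c
  | .arith o _ a b, l => o.eval (l.getD a 0) (l.getD b 0)
  | .load _ a, l => M (l.getD a 0)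
  | .store _ _, _ => 0

/-- The register written by an instruction; `none` for a store. -/
def Instr.target : Instr → Option ℕ
  | .const d _ => some d
  | .arith _ d _ _ => some d
  | .load d _ => some d
  | .store _ _ => none

/-- The effect of a sequence of instructions without stores on a list of registers. -/
def evalBlock (M : ℕ →₀ ℕ) : List Instr → List ℕ → List ℕ
  | [], l => l
  | i :: is, l => evalBlock M is (l.set (i.target.getD 0) (i.val M l))

/-- All values written by a sequence of instructions without stores are at most `L`. -/
def BlockOk (M : ℕ →₀ ℕ) (L : ℕ) : List Instr → List ℕ → Prop
  | [], _ => True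
  | i :: is, l => (∃ d < 24, i.target = some d) ∧ i.val M l ≤ L ∧
      BlockOk M L is (l.set (i.target.getD 0) (i.val M l))

/-- A sequence of instructions as a program. -/
def block : List Instr → Prog
  | [] => .skip
  | i :: is => .seq (.instr i) (block is)

/-- A list of `24` registers with values at most `L`. -/
def Bounded (L : ℕ) (l : List ℕ) : Prop := l.length = 24 ∧ ∀ x ∈ l, x ≤ L

/-- A bound for the time of one step on numbers that are at most `L`. -/
def stepTime (L : ℕ) : ℕ := (1 + Nat.size L) ^ 2

/-- A bound for the space of a state with memory `M` and `24` registers that are at most `L`. -/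
def space (M : ℕ →₀ ℕ) (L : ℕ) : ℕ := 24 * (24 + Nat.size L) + cellBits M

/-- With memory `M`, which is not changed, and registers that are at most `L` all the time, the
program `p` transforms the registers `l` into `l'` in at most `N` steps. -/
def Ev (M : ℕ →₀ ℕ) (L : ℕ) (p : Prog) (l l' : List ℕ) (N : ℕ) : Prop :=
  Bounded L l → Bounded L l' ∧ ∃ t b, Run p ⟨l.toFinsupp, M⟩ ⟨l'.toFinsupp, M⟩ t b ∧
    t ≤ N * stepTime L ∧ b ≤ space M L

theorem Bounded.getD_le {L : ℕ} {l : List ℕ} (h : Bounded L l) (i : ℕ) : l.getD i 0 ≤ L := by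
  by_cases hi : i < l.length
  · rw [List.getD_eq_getElem _ _ hi]
    exact h.2 _ (List.getElem_mem hi)
  · rw [List.getD_eq_default _ _ (not_lt.mp hi)]
    exact Nat.zero_le _

theorem Bounded.bits_le {L : ℕ} {l : List ℕ} (h : Bounded L l) (M : ℕ →₀ ℕ) :
    State.bits ⟨l.toFinsupp, M⟩ ≤ space M L := by
  unfold State.bits space
  gcongr
  unfold cellBits Finsupp.sum
  have hs : (l.toFinsupp).support ⊆ Finset.range 24 := by
    intro a ha
    rw [Finsupp.mem_support_iff, List.toFinsupp_apply] at ha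
    rw [Finset.mem_range]
    by_contra hc
    exact ha (List.getD_eq_default _ _ (h.1 ▸ not_lt.mp hc))
  calc _ ≤ (l.toFinsupp).support.card * (24 + Nat.size L) := by
        rw [← smul_eq_mul]
        refine Finset.sum_le_card_nsmul _ _ _ fun a ha => ?_
        have h1 := Finset.mem_range.mp (hs ha)
        have h2 : Nat.size a ≤ 24 := Nat.size_le.mpr (h1.trans (by norm_num))
        exact add_le_add h2 (Nat.size_le_size (by rw [List.toFinsupp_apply]; exact h.getD_le a))
    _ ≤ 24 * (24 + Nat.size L) := by
        gcongr
        simpa using Finset.card_le_card hs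

theorem toFinsupp_set {l : List ℕ} {d : ℕ} (hd : d < l.length) (v : ℕ) :
    (l.set d v).toFinsupp = l.toFinsupp.update d v := by
  ext i
  rw [List.toFinsupp_apply, Finsupp.update_apply, List.toFinsupp_apply]
  split_ifs with h
  · subst h
    rw [List.getD_eq_getElem?_getD, List.getElem?_set_self hd]; rfl
  · rw [List.getD_eq_getElem?_getD, List.getElem?_set_ne (Ne.symm h), List.getD_eq_getElem?_getD]

/-- Every cost fits under `(1 + Nat.size L) ^ 2`; schoolbook multiplication and division are the
extreme cases. -/
theorem Ev.instr {M : ℕ →₀ ℕ} {L : ℕ} {i : Instr} {l : List ℕ} {d : ℕ} (hd : d < 24)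
    (ht : i.target = some d) (hv : i.val M l ≤ L) :
    Ev M L (.instr i) l (l.set d (i.val M l)) 1 := by
  intro h
  have h' : Bounded L (l.set d (i.val M l)) := by
    refine ⟨by rw [List.length_set, h.1], fun x hx => ?_⟩
    rcases List.mem_or_eq_of_mem_set hx with hx | rfl
    · exact h.2 _ hx
    · exact hv
  have hd' : d < l.length := h.1 ▸ hd
  have he : i.exec ⟨l.toFinsupp, M⟩ = ⟨(l.set d (i.val M l)).toFinsupp, M⟩ := by
    rw [toFinsupp_set hd']
    cases i <;> simp [Instr.target] at ht <;> subst ht <;>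
      simp only [Instr.exec, Instr.val, List.toFinsupp_apply]
  have hr := Run.instr i ⟨l.toFinsupp, M⟩
  rw [he] at hr
  refine ⟨h', _, _, hr, ?_, max_le (h.bits_le M) (h'.bits_le M)⟩
  have hs (a : ℕ) : Nat.size (l.getD a 0) ≤ Nat.size L := Nat.size_le_size (h.getD_le a)
  have hsv := Nat.size_le_size hv
  unfold stepTime
  cases i with
  | const d c => simp only [Instr.cost, Instr.val] at *; nlinarith
  | arith o d a b =>
    have ha := hs a
    have hb := hs b
    cases o <;> simp only [Instr.cost, Op.cost, List.toFinsupp_apply] at * <;> nlinarith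
  | load d a =>
    have ha := hs a
    simp only [Instr.cost, Instr.val, List.toFinsupp_apply] at *; nlinarith
  | store a b => simp [Instr.target] at ht

theorem Ev.skip (M : ℕ →₀ ℕ) (L : ℕ) (l : List ℕ) : Ev M L .skip l l 1 := fun h =>
  ⟨h, _, _, Run.skip _, by rw [one_mul]; exact Nat.one_le_pow _ _ (by omega), h.bits_le M⟩

theorem Ev.seq {M : ℕ →₀ ℕ} {L : ℕ} {p q : Prog} {l l₁ l₂ : List ℕ} {N₁ N₂ : ℕ}
    (h₁ : Ev M L p l l₁ N₁) (h₂ : Ev M L q l₁ l₂ N₂) : Ev M L (.seq p q) l l₂ (N₁ + N₂) := by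
  intro h
  obtain ⟨b₁, t, b, hr, ht, hb⟩ := h₁ h
  obtain ⟨b₂, t', b', hr', ht', hb'⟩ := h₂ b₁
  exact ⟨b₂, _, _, hr.seq hr', by rw [add_mul]; exact add_le_add ht ht', max_le hb hb'⟩

theorem Ev.mono {M : ℕ →₀ ℕ} {L : ℕ} {p : Prog} {l l' : List ℕ} {N N' : ℕ}
    (h : Ev M L p l l' N) (hN : N ≤ N') : Ev M L p l l' N' := by
  intro hl
  obtain ⟨b₁, t, b, hr, ht, hb⟩ := h hl
  exact ⟨b₁, t, b, hr, ht.trans (Nat.mul_le_mul_right _ hN), hb⟩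

/-- Reduces straight-line code to a symbolic evaluation, often closed by `rfl`, and inequalities for
the written values. The extra step pays for the final `skip`. -/
theorem Ev.block {M : ℕ →₀ ℕ} {L : ℕ} {is : List Instr} {l l' : List ℕ}
    (he : evalBlock M is l = l') (h : BlockOk M L is l) :
    Ev M L (block is) l l' (is.length + 1) := by
  subst he
  induction is generalizing l with
  | nil => exact Ev.skip M L l
  | cons i is ih =>
    obtain ⟨⟨d, hd, ht⟩, hv, h⟩ := h
    simp only [evalBlock, ht, Option.getD_some] at h ⊢
    exact ((Ev.instr hd ht hv).seq (ih h)).mono (by simp; omega)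

theorem test_time {L x : ℕ} (hx : x ≤ L) : 1 + Nat.size x ≤ stepTime L := by
  have := Nat.size_le_size hx
  unfold stepTime
  nlinarith

theorem Ev.ite_true {M : ℕ →₀ ℕ} {L r : ℕ} {p q : Prog} {l l' : List ℕ} {N : ℕ}
    (h0 : l.getD r 0 ≠ 0) (h : Ev M L p l l' N) : Ev M L (.ite r p q) l l' (N + 1) := by
  intro hl
  obtain ⟨b₁, t, b, hr, ht, hb⟩ := h hl
  refine ⟨b₁, _, b, Run.ite_true (by simpa only [List.toFinsupp_apply] using h0) hr, ?_, hb⟩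
  have := test_time (hl.getD_le r)
  simp only [List.toFinsupp_apply]
  nlinarith

theorem Ev.ite_false {M : ℕ →₀ ℕ} {L r : ℕ} {p q : Prog} {l l' : List ℕ} {N : ℕ}
    (h0 : l.getD r 0 = 0) (h : Ev M L q l l' N) : Ev M L (.ite r p q) l l' (N + 1) := by
  intro hl
  obtain ⟨b₁, t, b, hr, ht, hb⟩ := h hl
  refine ⟨b₁, _, b, Run.ite_false (by simpa only [List.toFinsupp_apply] using h0) hr, ?_, hb⟩
  have := test_time (hl.getD_le r)
  simp only [List.toFinsupp_apply]
  nlinarith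

theorem Ev.loop_done {M : ℕ →₀ ℕ} {L r : ℕ} {p : Prog} {l : List ℕ}
    (h0 : l.getD r 0 = 0) : Ev M L (.loop r p) l l 1 := by
  intro hl
  refine ⟨hl, _, _, Run.loop_done (by simpa only [List.toFinsupp_apply] using h0), ?_,
    hl.bits_le M⟩
  have := test_time (hl.getD_le r)
  simp only [List.toFinsupp_apply]
  nlinarith

theorem Ev.loop_step {M : ℕ →₀ ℕ} {L r : ℕ} {p : Prog} {l l₁ l₂ : List ℕ} {N₁ N₂ : ℕ}
    (h0 : l.getD r 0 ≠ 0) (h₁ : Ev M L p l l₁ N₁) (h₂ : Ev M L (.loop r p) l₁ l₂ N₂) :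
    Ev M L (.loop r p) l l₂ (N₁ + N₂ + 1) := by
  intro h
  obtain ⟨b₁, t, b, hr, ht, hb⟩ := h₁ h
  obtain ⟨b₂, t', b', hr', ht', hb'⟩ := h₂ b₁
  refine ⟨b₂, _, _, Run.loop_step (by simpa only [List.toFinsupp_apply] using h0) hr hr', ?_,
    max_le hb hb'⟩
  have := test_time (h.getD_le r)
  simp only [List.toFinsupp_apply]
  nlinarith

end RAM

/-! ### Summing the matrix entries selected by a bit mask. -/

namespace RAM

/-- The sum of the cells `a + i` of `M` over the positions `i` of the binary digits `1` of `t`. -/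
def bitSum (M : ℕ →₀ ℕ) (a t : ℕ) : ℕ :=
  if t = 0 then 0 else t % 2 * M a + bitSum M (a + 1) (t / 2)
termination_by t
decreasing_by omega

/-- Adds `bitSum` of the address in register `20` and the mask in register `19` to
register `21`. -/
def bitSumLoop : Prog :=
  .loop 19 (block [.arith .div 22 19 3, .arith .mul 17 22 3, .arith .sub 17 19 17,
    .arith .add 19 22 23, .load 18 20, .arith .mul 18 18 17, .arith .add 21 21 18,
    .arith .add 20 20 2])

/-- Induction on a bound `s` for the length of the mask. Each round costs eight instructions, a
`skip` and a test. Register `23` stays `0`, so adding it copies a register; registers `2` and `3`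
hold the constants `1` and `2`. -/
theorem ev_bitSumLoop {M : ℕ →₀ ℕ} {L : ℕ} (hM : ∀ a, M a ≤ 1) (n k Z B₀ W pos neg cnt m kk
    idx B T Q sg : ℕ) (s : ℕ) : ∀ x y t a r h : ℕ, t < 2 ^ s → t ≤ L → 1 ≤ L → r + s ≤ L →
    a + s ≤ L → ∃ x' y' a' h', Ev M L bitSumLoop
      [n, k, 1, 2, Z, B₀, W, pos, neg, cnt, m, kk, idx, B, T, Q, sg, x, y, t, a, r, h, 0]
      [n, k, 1, 2, Z, B₀, W, pos, neg, cnt, m, kk, idx, B, T, Q, sg, x', y', 0, a',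
        r + bitSum M a t, h', 0] (s * 10 + 1) ∧ bitSum M a t ≤ s := by
  induction s with
  | zero =>
    intro x y t a r h ht _ _ _ _
    obtain rfl : t = 0 := by simpa using ht
    rw [bitSum, if_pos rfl]
    exact ⟨x, y, a, h, Ev.loop_done rfl, le_rfl⟩
  | succ s ih =>
    intro x y t a r h ht htL h1 hr ha
    rw [bitSum]
    split_ifs with h0
    · subst h0
      exact ⟨x, y, a, h, (Ev.loop_done rfl).mono (by omega), Nat.zero_le _⟩
    have hMa := hM a
    -- The machine has no remainder operation; parity is computed by halving and doubling.
    have hx : t - t / 2 * 2 = t % 2 := by omega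
    have hMx : M a * (t % 2) ≤ 1 := by
      have : t % 2 ≤ 1 := by omega
      nlinarith
    obtain ⟨x', y', a', h', hE, hb⟩ := ih (t - t / 2 * 2) (M a * (t - t / 2 * 2)) (t / 2) (a + 1)
      (r + M a * (t - t / 2 * 2)) (t / 2) (by rw [pow_succ] at ht; omega) (by omega) h1
      (by rw [hx]; omega) (by omega)
    refine ⟨x', y', a', h', ?_, by rw [mul_comm]; omega⟩
    have e : r + (t % 2 * M a + bitSum M (a + 1) (t / 2)) =
        r + M a * (t - t / 2 * 2) + bitSum M (a + 1) (t / 2) := by rw [hx]; ring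
    rw [e]
    refine Ev.mono (Ev.loop_step h0 (Ev.block rfl ?_) hE) (by simp; omega)
    simp only [BlockOk, Instr.target, Instr.val, Op.eval, Option.getD_some, List.set,
      List.getD_cons_zero, List.getD_cons_succ, Option.some.injEq, exists_eq_right', hx,
      Nat.reduceLT, true_and, and_true]
    and_intros <;> omega

end RAM

/-! ### Decoding pair numbers and accumulating the signed products. -/

namespace RAM

/-- The number of pairs of a `k`-subset of an `m`-set and a subset of it. -/
def numPairs (m k : ℕ) : ℕ := m.choose k * 2 ^ k

/-- This exact division updates the block size when the top vertex is dropped, so no table of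
binomial coefficients is needed. -/
theorem numPairs_mul_div (m k : ℕ) :
    numPairs (m + 1) k * (m + 1 - k) / (m + 1) = numPairs m k := by
  have h := Nat.choose_mul_succ_eq m k
  refine Nat.div_eq_of_eq_mul_left (Nat.succ_pos m) ?_
  unfold numPairs
  calc _ = (m + 1).choose k * (m + 1 - k) * 2 ^ k := by ring
    _ = _ := by rw [← h]; ring

theorem numPairs_succ_succ (m k : ℕ) :
    numPairs (m + 1) (k + 1) = numPairs m (k + 1) + 2 * numPairs m k := by
  unfold numPairs
  rw [Nat.choose_succ_succ]
  ring

theorem numPairs_succ_zero (m : ℕ) : numPairs (m + 1) 0 = numPairs m 0 := by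
  simp [numPairs]

/-- The signed product that belongs to the pair number `i` of a `k`-subset `A` of `{0, …, m - 1}`
and a subset `S` of `A`, where the binary digits of `t` describe the part of `S` outside
`{0, …, m - 1}`. -/
def signedProd (M : ℕ →₀ ℕ) (n Z : ℕ) : (m k i t : ℕ) → ℤ
  | 0, _, _, _ => 1
  | m + 1, k, i, t =>
    if i < numPairs m k then
      (1 + Z * bitSum M (m * n + m + 1) t : ℕ) * signedProd M n Z m k i (t + t)
    else if i - numPairs m k < numPairs m (k - 1) then
      -signedProd M n Z m (k - 1) (i - numPairs m k) (t + t)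
    else signedProd M n Z m (k - 1) (i - numPairs m k - numPairs m (k - 1)) (t + t + 1)

/-- Decides about one vertex. -/
def scanBody : Prog :=
  .seq (block [.arith .sub 17 10 11, .arith .mul 17 13 17, .arith .div 17 17 10,
    .arith .sub 10 10 2, .arith .sub 18 17 12])
  (.ite 18
    (.seq (block [.arith .add 13 17 23, .arith .add 19 14 23, .arith .mul 20 10 0,
        .arith .add 20 20 10, .arith .add 20 20 2, .const 21 0])
      (.seq bitSumLoop
        (block [.arith .mul 21 4 21, .arith .add 21 21 2, .arith .mul 15 15 21,
          .arith .add 14 14 14])))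
    (.seq (block [.arith .sub 12 12 17, .arith .sub 13 13 17, .arith .div 13 13 3,
        .arith .sub 11 11 2, .arith .add 14 14 14, .arith .sub 18 13 12])
      (.ite 18 (block [.arith .sub 16 2 16])
        (block [.arith .sub 12 12 13, .arith .add 14 14 2]))))

/-- Invariant: the sign exponent `sg` and the absolute value `Q` of the product so far, times the
`signedProd` still to come, stay constant. The bound on `Q * (1 + Z * n) ^ m` prevents overflow,
since each remaining factor is at most `1 + Z * n`. -/
theorem ev_scan {M : ℕ →₀ ℕ} {L : ℕ} (hM : ∀ a, M a ≤ 1) (n k Z B₀ W pos neg cnt : ℕ)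
    (hn : 2 ^ n ≤ L) (hn' : n * n + n ≤ L) (hZ : 1 + Z * n ≤ L) (m : ℕ) :
    ∀ kk idx T Q sg x y t a r h : ℕ, m ≤ n → T < 2 ^ (n - m) → sg ≤ 1 → idx < numPairs m kk →
    kk ≤ L → numPairs m kk * n ≤ L → Q * (1 + Z * n) ^ m ≤ L →
    ∃ kk' idx' B' T' Q' sg' x' y' t' a' r' h', Ev M L (.loop 10 scanBody)
      [n, k, 1, 2, Z, B₀, W, pos, neg, cnt, m, kk, idx, numPairs m kk, T, Q, sg, x, y, t, a, r,
        h, 0]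
      [n, k, 1, 2, Z, B₀, W, pos, neg, cnt, 0, kk', idx', B', T', Q', sg', x', y', t', a', r',
        h', 0] (m * (10 * n + 30) + 1) ∧ sg' ≤ 1 ∧ Q' ≤ Q * (1 + Z * n) ^ m ∧
      (-1) ^ sg' * (Q' : ℤ) = (-1) ^ sg * Q * signedProd M n Z m kk idx T := by
  induction m with
  | zero =>
    intro kk idx T Q sg x y t a r h _ _ hsg _ _ _ _
    exact ⟨kk, idx, numPairs 0 kk, T, Q, sg, x, y, t, a, r, h, (Ev.loop_done rfl).mono (by omega),
      hsg, by simp, by simp [signedProd]⟩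
  | succ m ih =>
    intro kk idx T Q sg x y t a r h hm hT hsg hidx hkk hB hQ
    have hT2 : T + T + 1 < 2 ^ (n - m) := by
      have : n - m = n - (m + 1) + 1 := by omega
      rw [this, pow_succ]
      omega
    have hTn : 2 ^ (n - m) ≤ 2 ^ n := Nat.pow_le_pow_right (by norm_num) (Nat.sub_le _ _)
    have hBL : numPairs (m + 1) kk ≤ numPairs (m + 1) kk * n := Nat.le_mul_of_pos_right _ (by omega)
    have hBx : numPairs (m + 1) kk * (m + 1 - kk) ≤ numPairs (m + 1) kk * n :=
      Nat.mul_le_mul_left _ (by omega)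
    have hdiv := numPairs_mul_div m kk
    have hN : numPairs m kk ≤ numPairs (m + 1) kk := by
      cases kk with
      | zero => rw [numPairs_succ_zero]
      | succ kk => rw [numPairs_succ_succ]; omega
    have hnn : n ≤ n * n + n := by omega
    have h1 : Ev M L (block [.arith .sub 17 10 11, .arith .mul 17 13 17, .arith .div 17 17 10,
        .arith .sub 10 10 2, .arith .sub 18 17 12])
        [n, k, 1, 2, Z, B₀, W, pos, neg, cnt, m + 1, kk, idx, numPairs (m + 1) kk, T, Q, sg, x, y,
          t, a, r, h, 0]
        [n, k, 1, 2, Z, B₀, W, pos, neg, cnt, m, kk, idx, numPairs (m + 1) kk, T, Q, sg,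
          numPairs m kk, numPairs m kk - idx, t, a, r, h, 0] 6 := by
      refine Ev.block ?_ ?_
      · rw [← hdiv]
        rfl
      simp only [BlockOk, Instr.target, Instr.val, Op.eval, Option.getD_some, List.set,
        List.getD_cons_zero, List.getD_cons_succ, Option.some.injEq, exists_eq_right', hdiv,
        Nat.reduceLT, true_and, and_true]
      and_intros <;> omega
    -- The program tests this through the truncated difference `numPairs m kk - idx`. Numbers in
    -- this first block leave vertex `m` outside `A`.
    by_cases hi : idx < numPairs m kk
    · have hmn : m * n + m + 1 + n ≤ n * n + n := by
        have : (m + 1) * n ≤ n * n := Nat.mul_le_mul_right _ hm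
        rw [add_mul] at this
        omega
      obtain ⟨x₁, y₁, a₁, h₁, hE, hb⟩ := ev_bitSumLoop (L := L) hM n k Z B₀ W pos neg cnt m kk idx
        (numPairs m kk) T Q sg n (numPairs m kk) (numPairs m kk - idx) T (m * n + m + 1) 0 h
        (by omega) (by omega) (by omega) (by omega) (by omega)
      rw [zero_add] at hE
      set ρ := bitSum M (m * n + m + 1) T with hρ
      have hZρ : Z * ρ + 1 ≤ 1 + Z * n := by
        rw [add_comm]
        gcongr
      have hQρ : Q * (Z * ρ + 1) * (1 + Z * n) ^ m ≤ Q * (1 + Z * n) ^ (m + 1) := by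
        rw [pow_succ', ← mul_assoc]
        gcongr
      have hQ1 : Q * (Z * ρ + 1) ≤ L := by
        refine le_trans ?_ (hQρ.trans hQ)
        exact Nat.le_mul_of_pos_right _ (by positivity)
      obtain ⟨kk', idx', B', T', Q', sg', x', y', t', a', r', h', hE', hsg', hQ', heq⟩ := ih kk idx
        (T + T) (Q * (Z * ρ + 1)) sg x₁ y₁ 0 a₁ (Z * ρ + 1) h₁ (by omega) (by omega) hsg hi hkk
        ((Nat.mul_le_mul_right _ hN).trans hB) (hQρ.trans hQ)
      refine ⟨kk', idx', B', T', Q', sg', x', y', t', a', r', h', ?_, hsg', hQ'.trans hQρ, ?_⟩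
      · refine Ev.mono (Ev.loop_step (Nat.succ_ne_zero m) (h1.seq (Ev.ite_true
          (Nat.sub_ne_zero_of_lt hi) (Ev.seq (Ev.block rfl ?_) (hE.seq (Ev.block rfl ?_))))) hE') ?_
        · simp only [BlockOk, Instr.target, Instr.val, Op.eval, Option.getD_some, List.set,
            List.getD_cons_zero, List.getD_cons_succ, Option.some.injEq, exists_eq_right',
            Nat.reduceLT, true_and, and_true]
          and_intros <;> omega
        · simp only [BlockOk, Instr.target, Instr.val, Op.eval, Option.getD_some, List.set,
            List.getD_cons_zero, List.getD_cons_succ, Option.some.injEq, exists_eq_right',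
            Nat.reduceLT, true_and, and_true]
          and_intros <;> omega
        · simp only [List.length_cons, List.length_nil]
          rw [add_mul]
          omega
      · rw [heq, signedProd, if_pos hi, ← hρ]
        push_cast
        ring
    -- With no elements of `A` left to choose, the first block is the whole range, so this branch
    -- needs `kk > 0`.
    · obtain _ | kk := kk
      · rw [numPairs_succ_zero] at hidx
        exact absurd hidx hi
      have hsplit := numPairs_succ_succ m kk
      -- The remaining numbers form two equal blocks: `m ∈ A \ T`, where the sign flips, and `m ∈
      -- T`, where the mask gains a bit.
      have hhalf : (numPairs (m + 1) (kk + 1) - numPairs m (kk + 1)) / 2 = numPairs m kk := by omega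
      have h2 : Ev M L (block [.arith .sub 12 12 17, .arith .sub 13 13 17, .arith .div 13 13 3,
          .arith .sub 11 11 2, .arith .add 14 14 14, .arith .sub 18 13 12])
          [n, k, 1, 2, Z, B₀, W, pos, neg, cnt, m, kk + 1, idx, numPairs (m + 1) (kk + 1), T, Q,
            sg, numPairs m (kk + 1), numPairs m (kk + 1) - idx, t, a, r, h, 0]
          [n, k, 1, 2, Z, B₀, W, pos, neg, cnt, m, kk, idx - numPairs m (kk + 1), numPairs m kk,
            T + T, Q, sg, numPairs m (kk + 1), numPairs m kk - (idx - numPairs m (kk + 1)), t, a,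
            r, h, 0] 7 := by
        refine Ev.block ?_ ?_
        · rw [← hhalf]
          rfl
        simp only [BlockOk, Instr.target, Instr.val, Op.eval, Option.getD_some, List.set,
          List.getD_cons_zero, List.getD_cons_succ, Option.some.injEq, exists_eq_right', hhalf,
          Nat.reduceLT, true_and, and_true]
        and_intros <;> omega
      have hQm : Q * (1 + Z * n) ^ m ≤ Q * (1 + Z * n) ^ (m + 1) := by
        gcongr <;> omega
      have hBm : numPairs m kk * n ≤ L := (Nat.mul_le_mul_right _ (by omega)).trans hB
      by_cases hi' : idx - numPairs m (kk + 1) < numPairs m kk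
      · obtain ⟨kk', idx', B', T', Q', sg', x', y', t', a', r', h', hE', hsg', hQ', heq⟩ := ih kk
          (idx - numPairs m (kk + 1)) (T + T) Q (1 - sg) (numPairs m (kk + 1))
          (numPairs m kk - (idx - numPairs m (kk + 1))) t a r h (by omega) (by omega) (by omega)
          hi' (by omega) hBm (hQm.trans hQ)
        refine ⟨kk', idx', B', T', Q', sg', x', y', t', a', r', h', ?_, hsg', hQ'.trans hQm, ?_⟩
        · refine Ev.mono (Ev.loop_step (Nat.succ_ne_zero m) (h1.seq (Ev.ite_false
            (Nat.sub_eq_zero_of_le (not_lt.mp hi)) (h2.seq (Ev.ite_true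
              (Nat.sub_ne_zero_of_lt hi') (Ev.block rfl ?_))))) hE') ?_
          · simp only [BlockOk, Instr.target, Instr.val, Op.eval,
              List.getD_cons_zero, List.getD_cons_succ, Option.some.injEq, exists_eq_right',
              Nat.reduceLT, true_and, and_true]
            omega
          · simp only [List.length_cons, List.length_nil]
            rw [add_mul]
            omega
        · rw [heq, signedProd, if_neg hi, Nat.add_sub_cancel, if_pos hi']
          interval_cases sg <;> simp
      · obtain ⟨kk', idx', B', T', Q', sg', x', y', t', a', r', h', hE', hsg', hQ', heq⟩ := ih kk
          (idx - numPairs m (kk + 1) - numPairs m kk) (T + T + 1) Q sg (numPairs m (kk + 1))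
          (numPairs m kk - (idx - numPairs m (kk + 1))) t a r h (by omega) (by omega) hsg
          (by omega) (by omega) hBm (hQm.trans hQ)
        refine ⟨kk', idx', B', T', Q', sg', x', y', t', a', r', h', ?_, hsg', hQ'.trans hQm, ?_⟩
        · refine Ev.mono (Ev.loop_step (Nat.succ_ne_zero m) (h1.seq (Ev.ite_false
            (Nat.sub_eq_zero_of_le (not_lt.mp hi)) (h2.seq (Ev.ite_false
              (Nat.sub_eq_zero_of_le (not_lt.mp hi')) (Ev.block rfl ?_))))) hE') ?_
          · simp only [BlockOk, Instr.target, Instr.val, Op.eval, Option.getD_some, List.set,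
              List.getD_cons_zero, List.getD_cons_succ, Option.some.injEq, exists_eq_right',
              Nat.reduceLT, true_and, and_true]
            and_intros <;> omega
          · simp only [List.length_cons, List.length_nil]
            rw [add_mul]
            omega
        · rw [heq, signedProd, if_neg hi, Nat.add_sub_cancel, if_neg hi']

/-- Adds the signed product of one pair to the accumulators in registers `7` and `8`. -/
def sumBody : Prog :=
  .seq (block [.arith .sub 9 9 2, .arith .add 10 0 23, .arith .add 11 1 23, .arith .add 12 9 23,
    .arith .add 13 5 23, .const 14 0, .const 15 1, .const 16 0])
  (.seq (.loop 10 scanBody) (.ite 16 (block [.arith .add 8 8 15]) (block [.arith .add 7 7 15])))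

/-- Registers hold natural numbers, so positive and negative products go to separate accumulators;
only their difference is meaningful. -/
theorem ev_sum {M : ℕ →₀ ℕ} {L : ℕ} (hM : ∀ a, M a ≤ 1) (n k Z W : ℕ)
    (hn : 2 ^ n ≤ L) (hn' : n * n + n ≤ L) (hZ : 1 + Z * n ≤ L) (hk : k ≤ L)
    (hB : numPairs n k * (n + 1) ≤ L) (hP : (1 + Z * n) ^ n ≤ L) (cnt : ℕ) :
    ∀ pos neg m kk idx B T Q sg x y t a r h : ℕ, cnt ≤ numPairs n k →
    pos + cnt * (1 + Z * n) ^ n ≤ L → neg + cnt * (1 + Z * n) ^ n ≤ L →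
    ∃ pos' neg' m' kk' idx' B' T' Q' sg' x' y' t' a' r' h', Ev M L (.loop 9 sumBody)
      [n, k, 1, 2, Z, numPairs n k, W, pos, neg, cnt, m, kk, idx, B, T, Q, sg, x, y, t, a, r, h, 0]
      [n, k, 1, 2, Z, numPairs n k, W, pos', neg', 0, m', kk', idx', B', T', Q', sg', x', y', t',
        a', r', h', 0] (cnt * (n * (10 * n + 30) + 20) + 1) ∧ pos' ≤ L ∧
      (pos' : ℤ) - neg' = pos - neg + ∑ i ∈ Finset.range cnt, signedProd M n Z n k i 0 := by
  induction cnt with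
  | zero =>
    intro pos neg m kk idx B T Q sg x y t a r h _ hpos _
    exact ⟨pos, neg, m, kk, idx, B, T, Q, sg, x, y, t, a, r, h, (Ev.loop_done rfl).mono (by omega),
      by omega, by simp⟩
  | succ cnt ih =>
    intro pos neg m kk idx B T Q sg x y t a r h hc hpos hneg
    rw [Nat.mul_add, mul_one] at hB
    obtain ⟨kk₁, idx₁, B₁, T₁, Q₁, sg₁, x₁, y₁, t₁, a₁, r₁, h₁, hE, hsg, hQ, heq⟩ := ev_scan hM n k
      Z (numPairs n k) W pos neg cnt hn hn' hZ n k cnt 0 1 0 x y t a r h le_rfl (by positivity)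
      (by omega) (by omega) hk (by omega) (by simpa using hP)
    rw [one_mul] at hQ
    rw [Nat.cast_one, pow_zero, one_mul, one_mul] at heq
    rw [add_mul, one_mul] at hpos hneg
    have hL : 1 ≤ L := by omega
    have hnL : n ≤ L := by omega
    have h0 : Ev M L (block [.arith .sub 9 9 2, .arith .add 10 0 23, .arith .add 11 1 23,
        .arith .add 12 9 23, .arith .add 13 5 23, .const 14 0, .const 15 1, .const 16 0])
        [n, k, 1, 2, Z, numPairs n k, W, pos, neg, cnt + 1, m, kk, idx, B, T, Q, sg, x, y, t, a,
          r, h, 0]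
        [n, k, 1, 2, Z, numPairs n k, W, pos, neg, cnt, n, k, cnt, numPairs n k, 0, 1, 0, x, y, t,
          a, r, h, 0] 9 := by
      refine Ev.block rfl ?_
      simp only [BlockOk, Instr.target, Instr.val, Op.eval, Option.getD_some, List.set,
        List.getD_cons_zero, List.getD_cons_succ, Option.some.injEq, exists_eq_right',
        Nat.reduceLT, true_and, and_true]
      and_intros <;> omega
    obtain rfl | rfl : sg₁ = 1 ∨ sg₁ = 0 := by omega
    · obtain ⟨pos', neg', m', kk', idx', B', T', Q', sg', x', y', t', a', r', h', hE', hL', heq'⟩ := ih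
        pos (neg + Q₁) 0 kk₁ idx₁ B₁ T₁ Q₁ 1 x₁ y₁ t₁ a₁ r₁ h₁ (by omega) (by omega) (by omega)
      refine ⟨pos', neg', m', kk', idx', B', T', Q', sg', x', y', t', a', r', h', ?_, hL', ?_⟩
      · refine Ev.mono (Ev.loop_step (Nat.succ_ne_zero cnt) (h0.seq (hE.seq (Ev.ite_true
          one_ne_zero (Ev.block rfl ?_)))) hE') ?_
        · simp only [BlockOk, Instr.target, Instr.val, Op.eval,
            List.getD_cons_zero, List.getD_cons_succ, Option.some.injEq, exists_eq_right',
            Nat.reduceLT, true_and, and_true]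
          omega
        · simp only [List.length_cons, List.length_nil]
          rw [add_mul cnt]
          omega
      · rw [heq', Finset.sum_range_succ, ← heq]
        push_cast
        ring
    · obtain ⟨pos', neg', m', kk', idx', B', T', Q', sg', x', y', t', a', r', h', hE', hL', heq'⟩ := ih
        (pos + Q₁) neg 0 kk₁ idx₁ B₁ T₁ Q₁ 0 x₁ y₁ t₁ a₁ r₁ h₁ (by omega) (by omega) (by omega)
      refine ⟨pos', neg', m', kk', idx', B', T', Q', sg', x', y', t', a', r', h', ?_, hL', ?_⟩
      · refine Ev.mono (Ev.loop_step (Nat.succ_ne_zero cnt) (h0.seq (hE.seq (Ev.ite_false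
          rfl (Ev.block rfl ?_)))) hE') ?_
        · simp only [BlockOk, Instr.target, Instr.val, Op.eval,
            List.getD_cons_zero, List.getD_cons_succ, Option.some.injEq, exists_eq_right',
            Nat.reduceLT, true_and, and_true]
          omega
        · simp only [List.length_cons, List.length_nil]
          rw [add_mul cnt]
          omega
      · rw [heq', Finset.sum_range_succ, ← heq]
        push_cast
        ring

end RAM

/-! ### The decoded products sum to the sum over pairs of sets. -/

namespace RAM

theorem bitSum_double (M : ℕ →₀ ℕ) (a t : ℕ) : bitSum M a (t + t) = bitSum M (a + 1) t := by
  rcases Nat.eq_zero_or_pos t with rfl | ht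
  · rw [bitSum, if_pos rfl, bitSum, if_pos rfl]
  · rw [bitSum, if_neg (by omega), show (t + t) % 2 = 0 by omega, show (t + t) / 2 = t by omega]
    simp

theorem bitSum_double_add_one (M : ℕ →₀ ℕ) (a t : ℕ) :
    bitSum M a (t + t + 1) = M a + bitSum M (a + 1) t := by
  rw [bitSum, if_neg (by omega), show (t + t + 1) % 2 = 1 by omega,
    show (t + t + 1) / 2 = t by omega, one_mul]

/-- The contribution of the sets `T ⊆ A ⊆ {0, …, m - 1}` without its sign, where the binary digits
of `t` describe further elements of `T` from `m` on. -/
def pairProd (M : ℕ →₀ ℕ) (n Z m t : ℕ) (A T : Finset ℕ) : ℤ :=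
  ∏ j ∈ Finset.range m \ A,
    ((1 + Z * (∑ i ∈ T with j < i, M (j * n + i) + bitSum M (j * n + m) t) : ℕ) : ℤ)

/-- No element of `T` exceeds `m`, so the factor of `m` sees only the mask. In the other factors the
mask now starts at `m`, with bit `0` clear. -/
theorem pairProd_succ_of_subset (M : ℕ →₀ ℕ) (n Z m t : ℕ) {A T : Finset ℕ}
    (hA : A ⊆ Finset.range m) (hT : T ⊆ A) : pairProd M n Z (m + 1) t A T =
      (1 + Z * bitSum M (m * n + m + 1) t : ℕ) * pairProd M n Z m (t + t) A T := by
  have hmA : m ∉ A := fun h => by simpa using hA h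
  unfold pairProd
  rw [Finset.range_add_one, Finset.insert_sdiff_of_notMem _ hmA, Finset.prod_insert (by simp)]
  congr 1
  · have : T.filter (m < ·) = ∅ := by
      refine Finset.filter_eq_empty_iff.mpr fun i hi => ?_
      have := Finset.mem_range.mp (hA (hT hi))
      omega
    rw [this, Finset.sum_empty, zero_add, add_assoc]
  · refine Finset.prod_congr rfl fun j _ => ?_
    rw [bitSum_double, add_assoc]

theorem pairProd_succ_insert (M : ℕ →₀ ℕ) (n Z m t : ℕ) (A T : Finset ℕ) :
    pairProd M n Z (m + 1) t (insert m A) T = pairProd M n Z m (t + t) A T := by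
  unfold pairProd
  have : Finset.range (m + 1) \ insert m A = Finset.range m \ A := by
    ext j
    simp only [Finset.mem_sdiff, Finset.mem_range, Finset.mem_insert]
    constructor
    · rintro ⟨h1, h2⟩
      exact ⟨by omega, fun h => h2 (Or.inr h)⟩
    · rintro ⟨h1, h2⟩
      exact ⟨by omega, fun h => h.elim (by omega) h2⟩
  rw [this]
  refine Finset.prod_congr rfl fun j _ => ?_
  rw [bitSum_double, add_assoc]

theorem pairProd_succ_insert_insert (M : ℕ →₀ ℕ) (n Z m t : ℕ) (A : Finset ℕ) {T : Finset ℕ}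
    (hT : T ⊆ Finset.range m) :
    pairProd M n Z (m + 1) t (insert m A) (insert m T) = pairProd M n Z m (t + t + 1) A T := by
  have hmT : m ∉ T := fun h => by simpa using hT h
  rw [pairProd_succ_insert]
  refine Finset.prod_congr rfl fun j hj => ?_
  have hj : j < m := Finset.mem_range.mp (Finset.mem_sdiff.mp hj).1
  rw [bitSum_double, bitSum_double_add_one, Finset.filter_insert, if_pos hj,
    Finset.sum_insert (fun h => hmT (Finset.mem_filter.mp h).1)]
  congr 3
  ring

/-- The signed sum of all products. -/
def pairSum (M : ℕ →₀ ℕ) (n Z m k t : ℕ) : ℤ :=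
  ∑ A ∈ (Finset.range m).powersetCard k, ∑ T ∈ A.powerset,
    (-1) ^ (k + T.card) * pairProd M n Z m t A T

theorem pairSum_succ_zero (M : ℕ →₀ ℕ) (n Z m t : ℕ) : pairSum M n Z (m + 1) 0 t =
    (1 + Z * bitSum M (m * n + m + 1) t : ℕ) * pairSum M n Z m 0 (t + t) := by
  simp only [pairSum, Finset.powersetCard_zero, Finset.sum_singleton, Finset.powerset_empty]
  rw [pairProd_succ_of_subset _ _ _ _ _ (Finset.empty_subset _) (Finset.empty_subset _)]
  simp

theorem pairSum_succ_succ (M : ℕ →₀ ℕ) (n Z m k t : ℕ) : pairSum M n Z (m + 1) (k + 1) t =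
    (1 + Z * bitSum M (m * n + m + 1) t : ℕ) * pairSum M n Z m (k + 1) (t + t) +
      (-pairSum M n Z m k (t + t) + pairSum M n Z m k (t + t + 1)) := by
  have hm : m ∉ Finset.range m := by simp
  conv_lhs => rw [pairSum, Finset.range_add_one, Finset.powersetCard_succ_insert hm]
  rw [Finset.sum_union, Finset.sum_image]
  · congr 1
    · rw [pairSum, Finset.mul_sum]
      refine Finset.sum_congr rfl fun A hA => ?_
      rw [Finset.mul_sum]
      refine Finset.sum_congr rfl fun T hT => ?_
      rw [pairProd_succ_of_subset _ _ _ _ _ (Finset.mem_powersetCard.mp hA).1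
        (Finset.mem_powerset.mp hT)]
      ring
    · rw [pairSum, pairSum, ← Finset.sum_neg_distrib, ← Finset.sum_add_distrib]
      refine Finset.sum_congr rfl fun A hA => ?_
      have hA := (Finset.mem_powersetCard.mp hA).1
      have hmA : m ∉ A := fun h => hm (hA h)
      rw [Finset.sum_powerset_insert hmA, ← Finset.sum_neg_distrib]
      congr 1
      · refine Finset.sum_congr rfl fun T hT => ?_
        rw [pairProd_succ_insert]
        ring
      · refine Finset.sum_congr rfl fun T hT => ?_
        have hT := Finset.mem_powerset.mp hT
        rw [pairProd_succ_insert_insert _ _ _ _ _ _ (hT.trans hA),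
          Finset.card_insert_of_notMem (fun h => hmA (hT h))]
        ring
  · intro A hA B hB h
    have hA : m ∉ A := fun h => hm ((Finset.mem_powersetCard.mp hA).1 h)
    have hB : m ∉ B := fun h => hm ((Finset.mem_powersetCard.mp hB).1 h)
    rw [← Finset.erase_insert hA, ← Finset.erase_insert hB]
    exact congrArg (Finset.erase · m) h
  · rw [Finset.disjoint_left]
    intro A hA hA'
    obtain ⟨B, -, rfl⟩ := Finset.mem_image.mp hA'
    exact hm ((Finset.mem_powersetCard.mp hA).1 (Finset.mem_insert_self m B))

/-- The index range splits into the three blocks of `signedProd`, matching the cases `m ∉ A`, `m ∈ A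
\ T` and `m ∈ T` of the recursion for `pairSum`. -/
theorem sum_signedProd (M : ℕ →₀ ℕ) (n Z m : ℕ) : ∀ k t : ℕ,
    ∑ i ∈ Finset.range (numPairs m k), signedProd M n Z m k i t = pairSum M n Z m k t := by
  induction m with
  | zero =>
    intro k t
    cases k with
    | zero => simp [numPairs, pairSum, pairProd, signedProd]
    | succ k =>
      rw [pairSum, Finset.powersetCard_eq_empty.mpr (by simp)]
      simp [numPairs]
  | succ m ih =>
    intro k t
    have h1 (k : ℕ) : ∑ i ∈ Finset.range (numPairs m k), signedProd M n Z (m + 1) k i t =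
        (1 + Z * bitSum M (m * n + m + 1) t : ℕ) * pairSum M n Z m k (t + t) := by
      rw [← ih, Finset.mul_sum]
      refine Finset.sum_congr rfl fun i hi => ?_
      rw [signedProd, if_pos (Finset.mem_range.mp hi)]
    cases k with
    | zero => rw [numPairs_succ_zero, h1, pairSum_succ_zero]
    | succ k =>
      rw [numPairs_succ_succ, two_mul, Finset.sum_range_add, h1, Finset.sum_range_add,
        pairSum_succ_succ, ← ih, ← ih, ← ih, ← Finset.sum_neg_distrib]
      congr 2
      · refine Finset.sum_congr rfl fun i hi => ?_
        have hi := Finset.mem_range.mp hi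
        rw [signedProd, if_neg (by omega), if_pos (by simpa using hi)]
        simp
      · refine Finset.sum_congr rfl fun i hi => ?_
        rw [signedProd, if_neg (by omega), if_neg (by simp)]
        simp

end RAM

/-! ### Inclusion-exclusion and generating functions for upward maps. -/

open Finset in
-- Writing `T = I ∪ U` with `U ⊆ A \ I`, the alternating sum over `U` vanishes unless `A \ I` is
-- empty.
theorem sum_superset_neg_one_pow {α : Type*} [DecidableEq α] (I A : Finset α) :
    ∑ T ∈ A.powerset, (if I ⊆ T then (-1 : ℤ) ^ (A.card + T.card) else 0) =
      if I = A then 1 else 0 := by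
  rw [← sum_filter]
  have hIcc : A.powerset.filter (I ⊆ ·) = Icc I A := by
    ext T
    simp [and_comm]
  rw [hIcc]
  by_cases hI : I ⊆ A
  · rw [Icc_eq_image_powerset hI, sum_image]
    · have h (U : Finset α) (hU : U ∈ (A \ I).powerset) :
          (-1 : ℤ) ^ (A.card + (I ∪ U).card) = (-1) ^ (A.card + I.card) * (-1) ^ U.card := by
        rw [card_union_of_disjoint (disjoint_of_subset_right (mem_powerset.mp hU) disjoint_sdiff)]
        ring
      rw [sum_congr rfl h, ← mul_sum, sum_powerset_neg_one_pow_card]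
      by_cases hIA : I = A
      · subst hIA
        simp [← two_mul]
      · rw [if_neg hIA, if_neg, mul_zero]
        rw [sdiff_eq_empty_iff_subset]
        exact fun h => hIA (hI.antisymm h)
    · intro U hU V hV h
      have hd {W : Finset α} (hW : W ∈ (A \ I).powerset) : (I ∪ W) \ I = W := by
        rw [union_sdiff_left]
        exact sdiff_eq_self_of_disjoint (disjoint_of_subset_left (mem_powerset.mp hW) sdiff_disjoint)
      rw [← hd hU, ← hd hV]
      exact congrArg (· \ I) h
  · rw [Icc_eq_empty (by simpa using hI), sum_empty, if_neg]
    rintro rfl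
    exact hI subset_rfl

section
open Finset
variable {V : Type*} [Fintype V] [LinearOrder V]

/-- The functions that move an element only upwards and along a pair in `F`. -/
def upwardMaps (F : Finset (Finset V)) : Finset (V → V) :=
  univ.filter fun f => ∀ j, f j = j ∨ (j < f j ∧ {j, f j} ∈ F)

/-- The elements moved by `f`. -/
def moved (f : V → V) : Finset V := univ.filter fun j => f j ≠ j

/-- Expanding the product chooses a value `f j` for each `j`: the summand `1` means `f j = j`, and
each admissible `i` contributes a `z`. -/
theorem prod_one_add_card_eq (F : Finset (Finset V)) (z : ℤ) (A T : Finset V) :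
    ∏ j ∈ univ \ A, (1 + z * (T.filter fun i => j < i ∧ {j, i} ∈ F).card) =
      ∑ f ∈ upwardMaps F,
        if Disjoint (moved f) A ∧ (moved f).image f ⊆ T then z ^ (moved f).card else 0 := by
  set t : V → Finset V := fun j => insert j
    (if j ∈ A then ∅ else T.filter fun i => j < i ∧ {j, i} ∈ F) with ht
  have h1 : ∏ j ∈ univ \ A, (1 + z * (T.filter fun i => j < i ∧ {j, i} ∈ F).card) =
      ∏ j, ∑ i ∈ t j, if i = j then 1 else z := by
    rw [← prod_subset (subset_univ (univ \ A))]
    · refine prod_congr rfl fun j hj => ?_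
      rw [ht]
      simp only [if_neg (mem_sdiff.mp hj).2]
      rw [sum_insert (by simp), if_pos rfl, sum_congr rfl (g := fun _ => z), sum_const,
        nsmul_eq_mul, mul_comm]
      intro i hi
      exact if_neg (mem_filter.mp hi).2.1.ne'
    · intro j _ hj
      have hj : j ∈ A := by simpa using hj
      simp [ht, hj]
  rw [h1, prod_univ_sum, ← sum_filter]
  refine sum_congr ?_ fun f _ => ?_
  · ext f
    simp only [Fintype.mem_piFinset, upwardMaps, mem_filter, mem_univ, true_and, ht, mem_insert,
      disjoint_left, moved, image_subset_iff, ← forall_and]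
    refine forall_congr' fun j => ?_
    by_cases hA : j ∈ A <;> by_cases hf : f j = j <;> simp [hA, hf, and_comm]
  · rw [moved, prod_ite]
    simp

/-- After exchanging sums, `sum_superset_neg_one_pow` with `I` the image of the moved elements
leaves only the term where this image equals `A`. -/
theorem sum_sum_prod_one_add_card_eq (F : Finset (Finset V)) (z : ℤ) (k : ℕ) :
    ∑ A ∈ univ.powersetCard k, ∑ T ∈ A.powerset, (-1) ^ (k + T.card) *
        ∏ j ∈ univ \ A, (1 + z * (T.filter fun i => j < i ∧ {j, i} ∈ F).card) =
      ∑ f ∈ (upwardMaps F).filter fun f => Disjoint (moved f) ((moved f).image f) ∧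
        ((moved f).image f).card = k, z ^ (moved f).card := by
  simp only [prod_one_add_card_eq, mul_sum]
  have hA (A : Finset V) (hA : A ∈ univ.powersetCard k) : ∑ T ∈ A.powerset, ∑ f ∈ upwardMaps F,
      ((-1) ^ (k + T.card) * if Disjoint (moved f) A ∧ (moved f).image f ⊆ T then
        z ^ (moved f).card else 0) = ∑ f ∈ upwardMaps F, if (moved f).image f = A then
          (if Disjoint (moved f) ((moved f).image f) then z ^ (moved f).card else 0) else 0 := by
    obtain rfl := (mem_powersetCard.mp hA).2
    rw [sum_comm]
    refine sum_congr rfl fun f _ => ?_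
    by_cases hd : Disjoint (moved f) A
    · simp only [hd, true_and]
      have := sum_superset_neg_one_pow ((moved f).image f) A
      have h2 := congrArg (· * z ^ (moved f).card) this
      simp only [sum_mul, ite_mul, zero_mul, one_mul] at h2
      simp only [mul_ite, mul_zero]
      rw [h2]
      split_ifs with h h'
      · rfl
      · exact absurd (h ▸ hd) h'
      · rfl
    · simp only [hd, false_and, if_false, mul_zero, sum_const_zero]
      split_ifs with h h'
      · exact absurd (h ▸ h') hd
      · rfl
      · rfl
  rw [sum_congr rfl hA, sum_comm, sum_filter]
  refine sum_congr rfl fun f _ => ?_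
  rw [sum_ite_eq, ← ite_and]
  simp [mem_powersetCard, and_comm]

/-- The upward maps that pair `k` elements with `k` other elements. -/
def matchingMaps (F : Finset (Finset V)) (k : ℕ) : Finset (V → V) :=
  (upwardMaps F).filter fun f => (Disjoint (moved f) ((moved f).image f) ∧
    ((moved f).image f).card = k) ∧ (moved f).card = k

/-- An image of size `k` needs at least `k` moved elements, so all other terms are divisible by `Z ^
(k + 1)`. -/
theorem exists_sum_eq_card_matchingMaps (F : Finset (Finset V)) (Z k : ℕ) :
    ∃ c : ℕ, ∑ A ∈ univ.powersetCard k, ∑ T ∈ A.powerset, (-1) ^ (k + T.card) *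
        ∏ j ∈ univ \ A, (1 + (Z : ℤ) * (T.filter fun i => j < i ∧ {j, i} ∈ F).card) =
      (((matchingMaps F k).card * Z ^ k + Z ^ (k + 1) * c : ℕ) : ℤ) := by
  rw [sum_sum_prod_one_add_card_eq]
  set G := (upwardMaps F).filter fun f => Disjoint (moved f) ((moved f).image f) ∧
        ((moved f).image f).card = k with hG
  refine ⟨∑ f ∈ G with ¬ (moved f).card = k, Z ^ ((moved f).card - (k + 1)), ?_⟩
  rw [← sum_filter_add_sum_filter_not G (fun f => (moved f).card = k)]
  push_cast
  congr 1
  · rw [matchingMaps, ← filter_filter, ← hG, sum_congr rfl (g := fun _ => (Z : ℤ) ^ k), sum_const,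
      nsmul_eq_mul]
    intro f hf
    rw [(mem_filter.mp hf).2]
  · rw [mul_sum]
    refine sum_congr rfl fun f hf => ?_
    rw [← pow_add]
    congr 1
    obtain ⟨hf, hf'⟩ := mem_filter.mp hf
    have h1 := (mem_filter.mp hf).2.2
    have h2 : ((moved f).image f).card ≤ (moved f).card := card_image_le
    omega

end

/-! ### Packings correspond to matching maps. -/

section
open Finset
theorem pair_eq_pair_of_lt {V : Type*} [LinearOrder V] {a b c d : V} (hab : a < b) (hcd : c < d)
    (h : ({a, b} : Finset V) = {c, d}) : a = c ∧ b = d := by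
  have ha : a ∈ ({c, d} : Finset V) := h ▸ mem_insert_self a _
  have hb : b ∈ ({c, d} : Finset V) := h ▸ mem_insert_of_mem (mem_singleton_self b)
  simp only [mem_insert, mem_singleton] at ha hb
  rcases ha with rfl | rfl <;> rcases hb with rfl | rfl
  · exact absurd hab (lt_irrefl _)
  · exact ⟨rfl, rfl⟩
  · exact absurd hab hcd.not_gt
  · exact absurd hab (lt_irrefl _)

variable {V : Type*} [Fintype V] [LinearOrder V]

theorem mem_moved {f : V → V} {j : V} : j ∈ moved f ↔ f j ≠ j := by simp [moved]

theorem lt_of_mem_moved {F : Finset (Finset V)} {f : V → V} (hf : f ∈ upwardMaps F) {j : V}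
    (hj : j ∈ moved f) : j < f j ∧ {j, f j} ∈ F :=
  ((mem_filter.mp hf).2 j).resolve_left (mem_moved.mp hj)

/-- The pairs that consist of a moved element and its image. -/
def pairsOf (f : V → V) : Finset (Finset V) := (moved f).image fun j => {j, f j}

theorem card_pairsOf {F : Finset (Finset V)} {f : V → V} (hf : f ∈ upwardMaps F) :
    (pairsOf f).card = (moved f).card :=
  card_image_of_injOn fun _ hi _ hj h =>
    (pair_eq_pair_of_lt (lt_of_mem_moved hf hi).1 (lt_of_mem_moved hf hj).1 h).1

theorem pair_mem_pairsOf {F : Finset (Finset V)} {f : V → V} (hf : f ∈ upwardMaps F) {a b : V}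
    (hab : a < b) : {a, b} ∈ pairsOf f ↔ f a = b := by
  constructor
  · intro h
    obtain ⟨j, hj, h⟩ := mem_image.mp h
    obtain ⟨rfl, rfl⟩ := pair_eq_pair_of_lt (lt_of_mem_moved hf hj).1 hab h
    rfl
  · rintro rfl
    exact mem_image.mpr ⟨a, mem_moved.mpr hab.ne', rfl⟩

/-- The order tells which end of a pair is moved, so the pairs determine the map. -/
theorem pairsOf_injOn (F : Finset (Finset V)) : Set.InjOn pairsOf (upwardMaps F : Set (V → V)) := by
  intro f hf g hg h
  funext j
  by_cases hj : j ∈ moved f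
  · have hlt := (lt_of_mem_moved hf hj).1
    have := (pair_mem_pairsOf hf hlt).mpr rfl
    rw [h] at this
    exact ((pair_mem_pairsOf hg hlt).mp this).symm
  · by_cases hj' : j ∈ moved g
    · have hlt := (lt_of_mem_moved hg hj').1
      have := (pair_mem_pairsOf hg hlt).mpr rfl
      rw [← h] at this
      exact (pair_mem_pairsOf hf hlt).mp this
    · rw [mem_moved, not_not] at hj hj'
      rw [hj, hj']

/-- Equal cardinalities make `f` injective on the moved elements, so upper ends differ; no upper end
is a lower end by disjointness. -/
theorem pairsOf_disjoint {F : Finset (Finset V)} {k : ℕ} {f : V → V} (hf : f ∈ matchingMaps F k) :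
    ∀ A ∈ pairsOf f, ∀ B ∈ pairsOf f, A ≠ B → Disjoint A B := by
  obtain ⟨-, ⟨hd, hI⟩, hS⟩ := mem_filter.mp hf
  have hinj : Set.InjOn f (moved f) := card_image_iff.mp (hI.trans hS.symm)
  have hne {i j : V} (hi : i ∈ moved f) (hj : j ∈ moved f) : i ≠ f j := fun h =>
    disjoint_left.mp hd hi (h ▸ mem_image_of_mem f hj)
  intro A hA B hB hAB
  obtain ⟨i, hi, rfl⟩ := mem_image.mp hA
  obtain ⟨j, hj, rfl⟩ := mem_image.mp hB
  have hij : i ≠ j := by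
    rintro rfl
    exact hAB rfl
  simp only [disjoint_insert_left, disjoint_singleton_left, mem_insert, mem_singleton, not_or]
  exact ⟨⟨hij, hne hi hj⟩, (hne hj hi).symm, fun h => hij (hinj hi hj h)⟩

theorem exists_pairsOf_eq {F : Finset (Finset V)} (hF : ∀ A ∈ F, A.card = 2) {P : Finset (Finset V)}
    (hPF : P ⊆ F) (hP : ∀ A ∈ P, ∀ B ∈ P, A ≠ B → Disjoint A B) :
    ∃ f ∈ matchingMaps F P.card, pairsOf f = P := by
  classical
  have hu {A B : Finset V} (hA : A ∈ P) (hB : B ∈ P) {a : V} (ha : a ∈ A) (hb : a ∈ B) :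
      A = B := by
    by_contra h
    exact disjoint_left.mp (hP A hA B hB h) ha hb
  -- Disjointness of the members of `P` makes the chosen partner unique.
  let f : V → V := fun j => if h : ∃ i, j < i ∧ {j, i} ∈ P then h.choose else j
  have hf1 {j : V} (hj : j ∈ moved f) : j < f j ∧ {j, f j} ∈ P := by
    have h : ∃ i, j < i ∧ {j, i} ∈ P := by
      by_contra h
      exact mem_moved.mp hj (dif_neg h)
    have e : f j = h.choose := dif_pos h
    rw [e]
    exact h.choose_spec
  have hfu : f ∈ upwardMaps F := by
    refine mem_filter.mpr ⟨mem_univ _, fun j => ?_⟩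
    by_cases hj : j ∈ moved f
    · exact Or.inr ⟨(hf1 hj).1, hPF (hf1 hj).2⟩
    · exact Or.inl (not_not.mp (mt mem_moved.mpr hj))
  have hfP : pairsOf f = P := by
    ext A
    constructor
    · intro hA
      obtain ⟨j, hj, rfl⟩ := mem_image.mp hA
      exact (hf1 hj).2
    · intro hA
      obtain ⟨a, b, hab, hAe⟩ : ∃ a b, a < b ∧ A = {a, b} := by
        obtain ⟨a, b, hab, rfl⟩ := card_eq_two.mp (hF A (hPF hA))
        rcases hab.lt_or_gt with h | h
        · exact ⟨a, b, h, rfl⟩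
        · exact ⟨b, a, h, pair_comm a b⟩
      subst hAe
      have h : ∃ i, a < i ∧ {a, i} ∈ P := ⟨b, hab, hA⟩
      have e : f a = h.choose := dif_pos h
      have ha : a ∈ moved f := mem_moved.mpr (by rw [e]; exact h.choose_spec.1.ne')
      exact mem_image.mpr ⟨a, ha, hu (hf1 ha).2 hA (mem_insert_self _ _) (mem_insert_self _ _)⟩
  have hcard : (moved f).card = P.card := by rw [← card_pairsOf hfu, hfP]
  refine ⟨f, mem_filter.mpr ⟨hfu, ⟨?_, ?_⟩, hcard⟩, hfP⟩
  · rw [disjoint_left]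
    intro i hi hi'
    obtain ⟨j, hj, rfl⟩ := mem_image.mp hi'
    have h := hu (hf1 hi).2 (hf1 hj).2 (mem_insert_self _ _)
      (mem_insert_of_mem (mem_singleton_self _))
    have := (pair_eq_pair_of_lt (hf1 hi).1 (hf1 hj).1 h).1
    exact mem_moved.mp hj this
  · rw [card_image_of_injOn, hcard]
    intro i hi j hj h
    have h' := hu (hf1 hi).2 (hf1 hj).2 (mem_insert_of_mem (mem_singleton_self _))
      (by rw [h]; exact mem_insert_of_mem (mem_singleton_self _))
    exact (pair_eq_pair_of_lt (hf1 hi).1 (hf1 hj).1 h').1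

end

theorem numPackings_eq_card_matchingMaps {n : ℕ} {F : Finset (Finset (Fin n))}
    (hF : ∀ A ∈ F, A.card = 2) (k : ℕ) : numPackings F k = (matchingMaps F k).card := by
  symm
  refine Finset.card_nbij pairsOf ?_ ?_ ?_
  · intro f hf
    have hfu := (Finset.mem_filter.mp hf).1
    refine Finset.mem_filter.mpr ⟨Finset.mem_powersetCard.mpr ⟨fun A hA => ?_, ?_⟩,
      pairsOf_disjoint hf⟩
    · obtain ⟨j, hj, rfl⟩ := Finset.mem_image.mp hA
      exact (lt_of_mem_moved hfu hj).2
    · rw [card_pairsOf hfu]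
      exact (Finset.mem_filter.mp hf).2.2
  · exact (pairsOf_injOn F).mono fun f hf => (Finset.mem_filter.mp hf).1
  · intro P hP
    obtain ⟨hP, hd⟩ := Finset.mem_filter.mp hP
    obtain ⟨hPF, rfl⟩ := Finset.mem_powersetCard.mp hP
    obtain ⟨f, hf, h⟩ := exists_pairsOf_eq hF hPF hd
    exact ⟨f, hf, h⟩

theorem numPackings_le {n : ℕ} {F : Finset (Finset (Fin n))} (hF : ∀ A ∈ F, A.card = 2) (k : ℕ) :
    numPackings F k ≤ n ^ n := by
  rw [numPackings_eq_card_matchingMaps hF]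
  simpa using Finset.card_le_univ (matchingMaps F k)

/-! ### Reading the input matrix as the family of pairs. -/

namespace RAM

/-- Row and column are recovered from the address as quotient and remainder modulo `n`. -/
theorem pairMatrix_apply {n : ℕ} (F : Finset (Finset (Fin n))) (j i : Fin n) :
    pairMatrix F (j * n + i) = if {j, i} ∈ F then 1 else 0 := by
  unfold pairMatrix
  rw [Finsupp.onFinset_apply]
  refine if_congr ⟨?_, fun h => ⟨j, i, rfl, h⟩⟩ rfl rfl
  rintro ⟨j', i', h, hF⟩
  have hi : i = i' := by
    have := congrArg (· % n) h
    simpa [Nat.add_mod, Nat.mod_eq_of_lt, Fin.ext_iff] using this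
  subst hi
  have hj : j = j' := Fin.ext (Nat.eq_of_mul_eq_mul_right (i.pos) (Nat.add_right_cancel h))
  exact hj ▸ hF

theorem pairMatrix_le_one {n : ℕ} (F : Finset (Finset (Fin n))) (a : ℕ) : pairMatrix F a ≤ 1 := by
  unfold pairMatrix
  rw [Finsupp.onFinset_apply]
  split_ifs <;> simp

theorem cellBits_pairMatrix_le {n : ℕ} (F : Finset (Finset (Fin n))) :
    cellBits (pairMatrix F) ≤ n * n * (n * n + 1) := by
  have hs : (pairMatrix F).support ⊆ Finset.range (n * n) := Finsupp.support_onFinset_subset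
  calc cellBits (pairMatrix F) ≤ (pairMatrix F).support.card * (n * n + 1) := by
        rw [cellBits, Finsupp.sum, ← smul_eq_mul]
        refine Finset.sum_le_card_nsmul _ _ _ fun a ha => ?_
        have h1 := Finset.mem_range.mp (hs ha)
        have h2 : Nat.size a ≤ n * n := Nat.size_le.mpr (h1.trans Nat.lt_two_pow_self)
        have h3 := Nat.size_le_size (pairMatrix_le_one F a)
        rw [Nat.size_one] at h3
        omega
    _ ≤ n * n * (n * n + 1) := by
        gcongr
        simpa using Finset.card_le_card hs

theorem sum_pairMatrix {n : ℕ} (F : Finset (Finset (Fin n))) (j : Fin n) (T : Finset (Fin n)) :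
    ∑ i ∈ T.map Fin.valEmbedding with (j : ℕ) < i, pairMatrix F (j * n + i) =
      (T.filter fun i => j < i ∧ {j, i} ∈ F).card := by
  rw [Finset.sum_filter, Finset.sum_map, Finset.card_filter]
  refine Finset.sum_congr rfl fun i _ => ?_
  rw [Fin.valEmbedding_apply, pairMatrix_apply, ite_and]
  simp only [Fin.lt_def]

theorem pairSum_pairMatrix {n : ℕ} (F : Finset (Finset (Fin n))) (Z k : ℕ) :
    pairSum (pairMatrix F) n Z n k 0 =
      ∑ A ∈ Finset.univ.powersetCard k, ∑ T ∈ A.powerset, (-1) ^ (k + T.card) *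
        ∏ j ∈ Finset.univ \ A,
          (1 + (Z : ℤ) * (T.filter fun i => j < i ∧ {j, i} ∈ F).card) := by
  have hr : Finset.range n = Finset.univ.map (Fin.valEmbedding (n := n)) := by
    rw [Fin.map_valEmbedding_univ, Nat.Iio_eq_range]
  have hp (A : Finset (Fin n)) : (A.map Fin.valEmbedding).powerset =
      A.powerset.map (Finset.mapEmbedding Fin.valEmbedding).toEmbedding := by
    ext T
    simp only [Finset.mem_powerset, Finset.mem_map]
    rw [Finset.subset_map_iff]
    constructor
    · rintro ⟨u, hu, rfl⟩
      exact ⟨u, hu, rfl⟩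
    · rintro ⟨u, hu, rfl⟩
      exact ⟨u, hu, rfl⟩
  rw [pairSum, hr, Finset.powersetCard_map, Finset.sum_map]
  refine Finset.sum_congr rfl fun A _ => ?_
  simp only [RelEmbedding.coe_toEmbedding, Finset.mapEmbedding_apply]
  rw [hp, Finset.sum_map]
  refine Finset.sum_congr rfl fun T _ => ?_
  simp only [RelEmbedding.coe_toEmbedding, Finset.mapEmbedding_apply, Finset.card_map]
  congr 1
  rw [pairProd, hr, ← Finset.map_sdiff, Finset.prod_map]
  refine Finset.prod_congr rfl fun j _ => ?_
  rw [Fin.valEmbedding_apply, sum_pairMatrix, bitSum, if_pos rfl]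
  push_cast
  ring

end RAM

/-! ### The complete program and its correctness. -/

namespace RAM

/-- Multiplies register `4` by a power of register `18`. -/
def powLoop : Prog := .loop 10 (block [.arith .mul 4 4 18, .arith .sub 10 10 2])

theorem ev_powLoop {M : ℕ →₀ ℕ} {L : ℕ} (n k y : ℕ) (hy : 1 ≤ y) (m : ℕ) : ∀ Z : ℕ,
    Z * y ^ m ≤ L → m ≤ L → Ev M L powLoop
      [n, k, 1, 2, Z, 0, 0, 0, 0, 0, m, 0, 0, 0, 0, 0, 0, 0, y, 0, 0, 0, 0, 0]
      [n, k, 1, 2, Z * y ^ m, 0, 0, 0, 0, 0, 0, 0, 0, 0, 0, 0, 0, 0, y, 0, 0, 0, 0, 0]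
      (m * 4 + 1) := by
  induction m with
  | zero =>
    intro Z _ _
    rw [pow_zero, mul_one]
    exact (Ev.loop_done rfl).mono (by omega)
  | succ m ih =>
    intro Z hZ hm
    rw [pow_succ', ← mul_assoc] at hZ ⊢
    have h1 : Z * y ≤ L := (Nat.le_mul_of_pos_right _ (by positivity)).trans hZ
    refine Ev.mono (Ev.loop_step (Nat.succ_ne_zero m) (Ev.block rfl ?_)
      (ih (Z * y) hZ (by omega))) (by simp only [List.length_cons, List.length_nil]; omega)
    simp only [BlockOk, Instr.target, Instr.val, Op.eval, Option.getD_some, List.set,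
      List.getD_cons_zero, List.getD_cons_succ, Option.some.injEq, exists_eq_right',
      Nat.reduceLT, true_and, and_true]
    and_intros <;> omega

theorem numPairs_succ_right (n i : ℕ) :
    numPairs n i * (n - i) / (i + 1) * 2 = numPairs n (i + 1) := by
  have h : numPairs n i * (n - i) / (i + 1) = n.choose (i + 1) * 2 ^ i := by
    refine Nat.div_eq_of_eq_mul_left (Nat.succ_pos i) ?_
    unfold numPairs
    calc _ = n.choose i * (n - i) * 2 ^ i := by ring
      _ = _ := by rw [← Nat.choose_succ_right_eq]; ring
  rw [h, numPairs, pow_succ, mul_assoc]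

theorem numPairs_le (n k : ℕ) : numPairs n k ≤ 2 ^ (n + k) := by
  rw [numPairs, pow_add]
  exact Nat.mul_le_mul_right _ (Nat.choose_le_two_pow n k)

/-- Computes the number of pairs in register `5` and a power of register `4` in register `6`. -/
def numPairsLoop : Prog :=
  .loop 10 (block [.arith .sub 17 0 11, .arith .mul 5 5 17, .arith .add 11 11 2,
    .arith .div 5 5 11, .arith .mul 5 5 3, .arith .mul 6 6 4, .arith .sub 10 10 2])

theorem ev_numPairsLoop {M : ℕ →₀ ℕ} {L : ℕ} (n k Z y : ℕ) (hZ : 1 ≤ Z) (hZk : Z ^ k ≤ L)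
    (hL : 2 ^ (n + k) * (n + 1) ≤ L) (hk : k ≤ L) (m : ℕ) :
    ∀ i x : ℕ, i + m = k → ∃ i' x', Ev M L numPairsLoop
      [n, k, 1, 2, Z, numPairs n i, Z ^ i, 0, 0, 0, m, i, 0, 0, 0, 0, 0, x, y, 0, 0, 0, 0, 0]
      [n, k, 1, 2, Z, numPairs n k, Z ^ k, 0, 0, 0, 0, i', 0, 0, 0, 0, 0, x', y, 0, 0, 0, 0, 0]
      (m * 9 + 1) := by
  induction m with
  | zero =>
    rintro i x rfl
    exact ⟨i, x, (Ev.loop_done rfl).mono (by omega)⟩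
  | succ m ih =>
    intro i x hi
    obtain ⟨i', x', h⟩ := ih (i + 1) (n - i) (by omega)
    have hB {j : ℕ} (hj : j ≤ k) : numPairs n j ≤ 2 ^ (n + k) :=
      (numPairs_le n j).trans (Nat.pow_le_pow_right (by norm_num) (by omega))
    have h1 : numPairs n i * (n - i) ≤ L :=
      (Nat.mul_le_mul (hB (by omega)) (by omega : n - i ≤ n + 1)).trans hL
    have h2 : numPairs n (i + 1) ≤ L :=
      (hB (by omega)).trans ((Nat.le_mul_of_pos_right _ (Nat.succ_pos n)).trans hL)
    have h3 : numPairs n i * (n - i) / (i + 1) ≤ L := (Nat.div_le_self _ _).trans h1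
    have h4 : Z ^ i * Z ≤ L := by
      rw [← pow_succ]
      exact (Nat.pow_le_pow_right hZ (by omega)).trans hZk
    have h5 : n ≤ L := le_trans (by nlinarith [Nat.one_le_two_pow (n := n + k)]) hL
    refine ⟨i', x', Ev.mono (Ev.loop_step (Nat.succ_ne_zero m) (Ev.block ?_ ?_) h)
      (by simp only [List.length_cons, List.length_nil]; omega)⟩
    · rw [← numPairs_succ_right]
      rfl
    simp only [BlockOk, Instr.target, Instr.val, Op.eval, Option.getD_some, List.set,
      List.getD_cons_zero, List.getD_cons_succ, Option.some.injEq, exists_eq_right',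
      Nat.reduceLT, true_and, and_true, numPairs_succ_right]
    and_intros <;> omega

/-- The program that counts packings. -/
def countPackings : Prog :=
  .seq (block [.const 2 1, .const 3 2, .const 4 2, .arith .add 10 0 23, .arith .add 18 0 2])
  (.seq powLoop
  (.seq (block [.const 5 1, .const 6 1, .arith .add 10 1 23, .const 11 0])
  (.seq numPairsLoop
  (.seq (block [.arith .add 9 5 23])
  (.seq (.loop 9 sumBody)
    (block [.arith .sub 0 7 8, .arith .div 0 0 6, .arith .div 17 0 4, .arith .mul 17 17 4,
      .arith .sub 0 0 17]))))))

theorem input_reg (n k : ℕ) (F : Finset (Finset (Fin n))) : input n k F =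
    ⟨[n, k, 0, 0, 0, 0, 0, 0, 0, 0, 0, 0, 0, 0, 0, 0, 0, 0, 0, 0, 0, 0, 0, 0].toFinsupp,
      pairMatrix F⟩ := by
  unfold input
  congr 1
  ext i
  rw [List.toFinsupp_apply, Finsupp.add_apply, Finsupp.single_apply, Finsupp.single_apply]
  by_cases hi : i < 24
  · interval_cases i <;> simp
  · rw [List.getD_eq_default _ _ (by simpa using hi), if_neg (by omega), if_neg (by omega),
      add_zero]

theorem ev_countPackings {n k L : ℕ} {F : Finset (Finset (Fin n))} (hF : ∀ A ∈ F, A.card = 2)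
    {Z : ℕ} (hZ : Z = 2 * (n + 1) ^ n) (hZL : 1 + Z * n ≤ L) (hZL' : Z ≤ L) (hZk : Z ^ k ≤ L)
    (hP : numPairs n k * (1 + Z * n) ^ n ≤ L) (hP' : (1 + Z * n) ^ n ≤ L)
    (hL : 2 ^ (n + k) * (n + 1) ≤ L)
    (hn : n * n + n ≤ L) (hk : k ≤ L) (h2 : 2 ≤ L) :
    ∃ l, l.getD 0 0 = numPackings F k ∧ Ev (pairMatrix F) L countPackings
      [n, k, 0, 0, 0, 0, 0, 0, 0, 0, 0, 0, 0, 0, 0, 0, 0, 0, 0, 0, 0, 0, 0, 0] l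
      (4 * n + 9 * k + numPairs n k * (n * (10 * n + 30) + 20) + 30) := by
  have hZ1 : 1 ≤ Z := by
    rw [hZ]
    exact Nat.succ_le_of_lt (by positivity)
  have hnL : n + 1 ≤ L := le_trans (Nat.le_mul_of_pos_left _ (by positivity)) hL
  have hNk : numPairs n k * (n + 1) ≤ L := (Nat.mul_le_mul_right _ (numPairs_le n k)).trans hL
  have hnk : numPairs n k ≤ L := (Nat.le_mul_of_pos_right _ (Nat.succ_pos n)).trans hNk
  have h2n : 2 ^ n ≤ L := by
    refine le_trans ?_ hL
    rw [pow_add, mul_assoc]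
    exact Nat.le_mul_of_pos_right _ (by positivity)
  have e1 := ev_powLoop (M := pairMatrix F) (L := L) n k (n + 1) (by omega) n 2 (hZ ▸ hZL')
    (by omega)
  rw [← hZ] at e1
  obtain ⟨i, x, e2⟩ := ev_numPairsLoop (M := pairMatrix F) n k Z (n + 1) hZ1 hZk hL hk k 0 0
    (zero_add k)
  obtain ⟨pos, neg, m, kk, idx, B, T, Q, sg, x', y, t, a, r, h, e3, hpos, hsum⟩ := ev_sum
    (pairMatrix_le_one F) n k Z (Z ^ k) h2n hn hZL hk hNk hP' (numPairs n k) 0 0 0 i 0 0 0 0 0 x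
    (n + 1) 0 0 0 0 le_rfl (by omega) (by omega)
  rw [sum_signedProd, pairSum_pairMatrix] at hsum
  obtain ⟨c, hc⟩ := exists_sum_eq_card_matchingMaps F Z k
  rw [hc, ← numPackings_eq_card_matchingMaps hF] at hsum
  -- The factor `2` in `Z` keeps this strict for `n = 0`, where `n ^ n = (n + 1) ^ n = 1`.
  have hlt : numPackings F k < Z := by
    have h1 := numPackings_le hF k
    have h2 : n ^ n ≤ (n + 1) ^ n := Nat.pow_le_pow_left (Nat.le_succ n) n
    have h3 : 0 < (n + 1) ^ n := by positivity
    omega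
  -- The signed total is a natural number, so truncated subtraction is exact.
  have hdiff : pos - neg = (numPackings F k + Z * c) * Z ^ k := by
    have : (numPackings F k + Z * c) * Z ^ k = numPackings F k * Z ^ k + Z ^ (k + 1) * c := by ring
    rw [this]
    omega
  have hquot : (pos - neg) / Z ^ k = numPackings F k + Z * c := by
    rw [hdiff, Nat.mul_div_cancel _ (by positivity)]
  have hquot' : (pos - neg) / Z ^ k / Z = c := by
    rw [hquot, Nat.add_mul_div_left _ _ hZ1, Nat.div_eq_of_lt hlt, zero_add]
  have hres : (pos - neg) / Z ^ k - (pos - neg) / Z ^ k / Z * Z = numPackings F k := by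
    rw [hquot', hquot, mul_comm c, Nat.add_sub_cancel]
  have hq1 : (pos - neg) / Z ^ k ≤ L := (Nat.div_le_self _ _).trans (by omega)
  have hq2 : (pos - neg) / Z ^ k / Z ≤ L := (Nat.div_le_self _ _).trans hq1
  have hq3 : (pos - neg) / Z ^ k / Z * Z ≤ L := (Nat.div_mul_le_self _ _).trans hq1
  refine ⟨[(pos - neg) / Z ^ k - (pos - neg) / Z ^ k / Z * Z, k, 1, 2, Z, numPairs n k, Z ^ k, pos,
    neg, 0, m, kk, idx, B, T, Q, sg, (pos - neg) / Z ^ k / Z * Z, y, t, a, r, h, 0], hres, Ev.mono (Ev.seq (Ev.block rfl ?_) (e1.seq (Ev.seq (Ev.block ?_ ?_) (e2.seq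
    (Ev.seq (Ev.block rfl ?_) (e3.seq (Ev.block rfl ?_))))))) ?_⟩
  · simp only [BlockOk, Instr.target, Instr.val, Op.eval, Option.getD_some, List.set,
      List.getD_cons_zero, List.getD_cons_succ, Option.some.injEq, exists_eq_right',
      Nat.reduceLT, true_and, and_true]
    and_intros <;> omega
  · rw [numPairs, Nat.choose_zero_right]
    rfl
  · simp only [BlockOk, Instr.target, Instr.val, Op.eval, Option.getD_some, List.set,
      List.getD_cons_zero, List.getD_cons_succ, Option.some.injEq, exists_eq_right',
      Nat.reduceLT, true_and, and_true]
    and_intros <;> omega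
  · simp only [BlockOk, Instr.target, Instr.val, Op.eval,
      List.getD_cons_zero, List.getD_cons_succ, Option.some.injEq, exists_eq_right',
      Nat.reduceLT, true_and, and_true]
    omega
  · simp only [BlockOk, Instr.target, Instr.val, Op.eval, Option.getD_some, List.set,
      List.getD_cons_zero, List.getD_cons_succ, Option.some.injEq, exists_eq_right',
      Nat.reduceLT, true_and, and_true]
    and_intros <;> omega
  · simp only [List.length_cons, List.length_nil]
    omega

end RAM

/-! ### Polynomial bounds for time and space. -/

open RAM in
theorem corollary6 :
    ∃ (P : RAM.Prog) (c : ℕ), ∀ (n k : ℕ) (F : Finset (Finset (Fin n))),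
      (∀ A ∈ F, A.card = 2) →
      ∃ (s : RAM.State) (t b : ℕ),
        RAM.Run P (RAM.input n k F) s t b ∧
        s.reg 0 = numPackings F k ∧
        t ≤ c * (n + k + 1) ^ c * (3 ^ k * max 1 (n.choose k)) ∧
        b ≤ c * (n + k + 1) ^ c := by
  obtain ⟨c, hc⟩ : ∃ c, c = 28800 := ⟨_, rfl⟩
  refine ⟨countPackings, c, fun n k F hF => ?_⟩
  obtain ⟨s, hs⟩ : ∃ s, s = n + k + 1 := ⟨_, rfl⟩
  rw [← hs]
  have hs1 : 1 ≤ s := by omega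
  have hns : n + 1 ≤ s := by omega
  have hs2 : s ≤ s ^ 2 := Nat.le_self_pow (by norm_num) s
  have hs3 : s ^ 2 ≤ s ^ 3 := Nat.pow_le_pow_right hs1 (by norm_num)
  have hs4 : s ^ 3 ≤ s ^ 4 := Nat.pow_le_pow_right hs1 (by norm_num)
  have hexp {a b : ℕ} (h : a ≤ b) : 2 ^ a ≤ 2 ^ b := Nat.pow_le_pow_right (by norm_num) h
  have hn2 : n + 1 ≤ 2 ^ s := hns.trans Nat.lt_two_pow_self.le
  obtain ⟨Z, hZ⟩ : ∃ Z, Z = 2 * (n + 1) ^ n := ⟨_, rfl⟩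
  have hZ2 : Z ≤ 2 ^ s ^ 2 := by
    calc Z ≤ 2 * (2 ^ s) ^ n := by rw [hZ]; gcongr
      _ = 2 ^ (s * n + 1) := by rw [← pow_mul, pow_succ, mul_comm]
      _ ≤ 2 ^ s ^ 2 := hexp (by nlinarith)
  have hZ1 : 1 ≤ Z := by
    rw [hZ]
    exact Nat.succ_le_of_lt (by positivity)
  have hQ : 1 + Z * n ≤ 2 ^ (2 * s ^ 2) := by
    calc 1 + Z * n ≤ Z * (n + 1) := by rw [Nat.mul_add, mul_one]; omega
      _ ≤ 2 ^ s ^ 2 * 2 ^ s := Nat.mul_le_mul hZ2 hn2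
      _ = 2 ^ (s ^ 2 + s) := (pow_add _ _ _).symm
      _ ≤ 2 ^ (2 * s ^ 2) := hexp (by omega)
  have hQn : (1 + Z * n) ^ n ≤ 2 ^ (2 * s ^ 3) := by
    calc (1 + Z * n) ^ n ≤ (2 ^ (2 * s ^ 2)) ^ n := Nat.pow_le_pow_left hQ n
      _ = 2 ^ (2 * s ^ 2 * n) := by rw [← pow_mul]
      _ ≤ 2 ^ (2 * s ^ 3) := hexp (by rw [pow_succ s 2, ← mul_assoc]; gcongr; omega)
  have hN : numPairs n k ≤ 2 ^ s := (numPairs_le n k).trans (hexp (by omega))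
  -- The largest quantities are at most about `2 ^ (3 * s ^ 3)`; the exponent `10 * s ^ 3` leaves
  -- room for all side conditions and keeps registers polynomially long.
  obtain ⟨l, hl, hE⟩ := ev_countPackings (k := k) (L := 2 ^ (10 * s ^ 3)) hF hZ
    (hQ.trans (hexp (by omega))) (hZ2.trans (hexp (by omega)))
    (by
      calc Z ^ k ≤ (2 ^ s ^ 2) ^ k := Nat.pow_le_pow_left hZ2 k
        _ = 2 ^ (s ^ 2 * k) := by rw [← pow_mul]
        _ ≤ 2 ^ (s ^ 2 * s) := hexp (Nat.mul_le_mul_left _ (by omega))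
        _ ≤ _ := hexp (by rw [← pow_succ]; change s ^ 3 ≤ _; omega))
    (by
      calc numPairs n k * (1 + Z * n) ^ n ≤ 2 ^ s * 2 ^ (2 * s ^ 3) := Nat.mul_le_mul hN hQn
        _ = 2 ^ (s + 2 * s ^ 3) := (pow_add _ _ _).symm
        _ ≤ _ := hexp (by omega))
    (hQn.trans (hexp (by omega)))
    (by
      calc 2 ^ (n + k) * (n + 1) ≤ 2 ^ s * 2 ^ s := Nat.mul_le_mul (hexp (by omega)) hn2
        _ = 2 ^ (s + s) := (pow_add _ _ _).symm
        _ ≤ _ := hexp (by omega))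
    (by
      calc n * n + n ≤ (n + 1) * (n + 1) := by nlinarith
        _ ≤ 2 ^ s * 2 ^ s := Nat.mul_le_mul hn2 hn2
        _ = 2 ^ (s + s) := (pow_add _ _ _).symm
        _ ≤ _ := hexp (by omega))
    ((Nat.lt_two_pow_self (n := k)).le.trans (hexp (by omega)))
    (by simpa using hexp (show 1 ≤ 10 * s ^ 3 by omega))
  have hsize : Nat.size (2 ^ (10 * s ^ 3)) = 10 * s ^ 3 + 1 := Nat.size_pow
  obtain ⟨-, t, b, hR, ht, hb⟩ := hE ⟨rfl, by
    have h1 : n ≤ 2 ^ (10 * s ^ 3) := (by omega : n ≤ 2 ^ s).trans (hexp (by omega))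
    have h2 : k ≤ 2 ^ (10 * s ^ 3) := (Nat.lt_two_pow_self (n := k)).le.trans (hexp (by omega))
    simp [h1, h2]⟩
  refine ⟨_, t, b, (input_reg n k F) ▸ hR, by rw [List.toFinsupp_apply, hl], ht.trans ?_,
    hb.trans ?_⟩
  · set X := 3 ^ k * max 1 (n.choose k) with hX
    have hX1 : 1 ≤ X := Nat.mul_pos (by positivity) (by positivity)
    -- Only `2 ^ k ≤ 3 ^ k` is needed here. The maximum with `1` matters for `k > n`, where there
    -- are no pairs but the setup still takes time.
    have hNX : numPairs n k ≤ X := by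
      rw [numPairs, mul_comm]
      exact Nat.mul_le_mul (Nat.pow_le_pow_left (by norm_num) k) (le_max_right _ _)
    have hsteps : 4 * n + 9 * k + numPairs n k * (n * (10 * n + 30) + 20) + 30 ≤
        200 * s ^ 2 * X := by
      have h1 : n * (10 * n + 30) + 20 ≤ 60 * s ^ 2 := by nlinarith
      calc _ ≤ 43 * s ^ 2 * 1 + X * (60 * s ^ 2) := by
            have := Nat.mul_le_mul hNX h1
            omega
        _ ≤ 43 * s ^ 2 * X + X * (60 * s ^ 2) := by gcongr
        _ ≤ 200 * s ^ 2 * X := by nlinarith [Nat.zero_le (s ^ 2 * X)]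
    have htime : stepTime (2 ^ (10 * s ^ 3)) ≤ 144 * s ^ 6 := by
      rw [stepTime, hsize]
      calc (1 + (10 * s ^ 3 + 1)) ^ 2 ≤ (12 * s ^ 3) ^ 2 := Nat.pow_le_pow_left (by omega) 2
        _ = 144 * s ^ 6 := by ring
    -- The constant `28800` is `200 * 144`; it also exceeds the exponent `8` and the space constant
    -- `842`.
    calc _ ≤ 200 * s ^ 2 * X * (144 * s ^ 6) := Nat.mul_le_mul hsteps htime
      _ = 28800 * s ^ 8 * X := by ring
      _ ≤ c * s ^ c * X := Nat.mul_le_mul_right _ (Nat.mul_le_mul (by omega)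
        (Nat.pow_le_pow_right hs1 (by omega)))
  · have hM : cellBits (pairMatrix F) ≤ 2 * s ^ 4 := by
      refine (cellBits_pairMatrix_le F).trans ?_
      have h1 : n * n ≤ s ^ 2 := by nlinarith
      calc n * n * (n * n + 1) ≤ s ^ 2 * (s ^ 2 + s ^ 2) := by gcongr; omega
        _ = 2 * s ^ 4 := by ring
    calc space (pairMatrix F) (2 ^ (10 * s ^ 3)) ≤ 842 * s ^ 4 := by
          rw [space, hsize]
          omega
      _ ≤ c * s ^ c := Nat.mul_le_mul (by omega)
        (Nat.pow_le_pow_right hs1 (by omega))
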